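/- Let $E^4_1$ be $\mathbb{R}^4$ with the metric $h(x,y)=x^1y^1+x^2y^2+x^3y^3-x^4y^4$ and the standard orientation, and let $\hat h$ be the induced metric on $\bigwedge^2E^4_1$, $\hat h(x\wedge y,u\wedge v)=h(x,u)h(y,v)-h(x,v)h(y,u)$, with its flat Levi-Civita connection $\hat\nabla$. Let $SO(3,1)$ be the group of linear maps of $E^4_1$ that preserve $h$ and have determinant $1$; it acts on $\bigwedge^2E^4_1$ by $\tilde T_P(x\wedge y)=Px\wedge Py$. Let $(e_1,e_2,e_3,e_4)$ be a positively oriented pseudo-orthonormal basis of $E^4_1$ with $e_1,e_2,e_3$ space-like and $e_4$ time-like, and put $\omega_{ij}=e_i\wedge e_j$, $$\Omega=\sqrt2\,(\cos\phi\,\omega_{12}+\sin\phi\,\omega_{23}+\omega_{34}),\qquad \mathcal L(\Omega)=\{\tilde T_P(\Omega)\mid P\in SO(3,1)\},$$ $$E_{\pm,1}=\tfrac1{\sqrt2}(\omega_{12}\pm\omega_{34}),\quad E_{\pm,2}=\tfrac1{\sqrt2}(\omega_{13}\pm\omega_{42}),\quad E_{\pm,3}=\tfrac1{\sqrt2}(\omega_{14}\pm\omega_{23}),$$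 $$X_\pm=\sin\phi\,E_{\pm,1}\mp\cos\phi\,E_{\pm,3}-E_{\mp,3},\qquad Y_\pm=E_{\pm,2}.$$ Let $P_{2,1}(\theta)$ be the rotation $e_1\mapsto\cos\theta\,e_1+\sin\theta\,e_3$, $e_3\mapsto-\sin\theta\,e_1+\cos\theta\,e_3$ (fixing $e_2,e_4$), and $P_{2,2}(t)$ the boost $e_2\mapsto\cosh t\,e_2+\sinh t\,e_4$, $e_4\mapsto\sinh t\,e_2+\cosh t\,e_4$ (fixing $e_1,e_3$). Write $\tilde T^P_{\theta,t}=\tilde T_P\circ\tilde T_{P_{2,1}(\theta)}\circ\tilde T_{P_{2,2}(t)}$ for $P\in SO(3,1)$. **Theorem.** Suppose $\phi=\pi/2$. Then there is a smooth involutive distribution $\mathcal D$ of rank two on $\mathcal L(\Omega)$ on which the metric $\hat h^\top$ induced by $\hat h$ on $\mathcal L(\Omega)$ is degenerate; precisely, $\mathcal D_\Theta$ is the radical of $\hat h^\top$ on $T_\Theta\mathcal L(\Omega)$ for each $\Theta\in\mathcal L(\Omega)$. For every $P\in SO(3,1)$, the map $(\theta,t)\mapsto\tilde T^P_{\theta,t}(\Omega)$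 is an immersed integral surface of $\mathcal D$. If $\mathcal S$ is any connected (immersed) integral surface of $\mathcal D$ and $P\in SO(3,1)$ is such that $\tilde T_P(\Omega)\in\mathcal S$, then $\mathcal S\subset\{\tilde T^P_{\theta,t}(\Omega)\mid\theta,t\in\mathbb R\}$, there are well-defined smooth vector fields $\tilde X_\pm,\tilde Y_\pm$ along $\mathcal S$ whose values at $\tilde T^P_{\theta,t}(\Omega)$ are $\tilde T^P_{\theta,t}(X_\pm)$ and $\tilde T^P_{\theta,t}(Y_\pm)$, and for every tangent vector $v$ of $\mathcal S$ the covariant derivative $\hat\nabla_v\tilde X_\pm$ is zero or light-like (nonzero and null for $\hat h$) and is tangent to $\mathcal S$, while $\hat\nabla_v\tilde Y_\pm=0$. -/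

import Mathlib

noncomputable section

namespace MinkowskiBivector

open scoped Manifold ContDiff
open Set

/-! ## Minkowski 4-space and its second exterior power (indices `0,1,2,3` stand for `1,2,3,4`) -/

/-- The vector space underlying Minkowski 4-space. -/
abbrev E41 : Type := Fin 4 → ℝ

/-- The signs `(+,+,+,-)`. -/
def sgn : Fin 4 → ℝ := ![1, 1, 1, -1]

/-- The Minkowski metric `h(x,y) = x¹y¹ + x²y² + x³y³ - x⁴y⁴`. -/
def hMink : LinearMap.BilinForm ℝ E41 := Matrix.toBilin' (Matrix.diagonal sgn)

theorem hMink_apply (x y : E41) :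
    hMink x y = x 0 * y 0 + x 1 * y 1 + x 2 * y 2 - x 3 * y 3 := by
  simp [hMink, Matrix.toBilin'_apply', Matrix.mulVec_diagonal, dotProduct, Fin.sum_univ_four, sgn]
  ring

/-- The 2-fold exterior power of Minkowski 4-space. -/
abbrev Bivec : Type := ⋀[ℝ]^2 E41

/-- The norm on `⋀² E` transported from `ℝⁿ` by a linear isomorphism. It serves only to speak of
limits, smoothness and derivatives, for which all norms on this finite-dimensional space agree. -/
instance : NormedAddCommGroup Bivec :=
  NormedAddCommGroup.induced Bivec (Fin (Module.finrank ℝ Bivec) → ℝ)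
    (Module.finBasis ℝ Bivec).equivFun.toLinearMap
    (Module.finBasis ℝ Bivec).equivFun.injective

instance : NormedSpace ℝ Bivec :=
  NormedSpace.induced ℝ Bivec (Fin (Module.finrank ℝ Bivec) → ℝ)
    (Module.finBasis ℝ Bivec).equivFun.toLinearMap

/-- `x ∧ y`. -/
def wedge (x y : E41) : Bivec := exteriorPower.ιMulti ℝ 2 ![x, y]

/-- The metric `ĥ` on `⋀² E` induced by `h`. -/
def hHat : LinearMap.BilinForm ℝ Bivec :=
  exteriorPower.pairingDual ℝ E41 2 ∘ₗ exteriorPower.map 2 hMink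

theorem hHat_wedge (x y u v : E41) :
    hHat (wedge x y) (wedge u v) = hMink x u * hMink y v - hMink x v * hMink y u := by
  simp only [hHat, wedge, LinearMap.comp_apply, exteriorPower.map_apply_ιMulti]
  rw [exteriorPower.pairingDual_ιMulti_ιMulti, Matrix.det_fin_two]
  simp
  ring

/-- A vector is light-like if it is nonzero and null. -/
def IsLightlike (v : Bivec) : Prop := v ≠ 0 ∧ hHat v v = 0

/-- `SO(3,1)`, as the linear maps of `E` of determinant one that preserve `h`. -/
def SO31 : Set (E41 →ₗ[ℝ] E41) :=
  {P | (∀ x y, hMink (P x) (P y) = hMink x y) ∧ LinearMap.det P = 1}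

/-- The linear map `T̃_P` of `⋀² E` with `T̃_P (x ∧ y) = Px ∧ Py`. -/
def tilde (P : E41 →ₗ[ℝ] E41) : Bivec →ₗ[ℝ] Bivec := exteriorPower.map 2 P

theorem tilde_wedge (P : E41 →ₗ[ℝ] E41) (x y : E41) :
    tilde P (wedge x y) = wedge (P x) (P y) := by
  simp only [tilde, wedge, exteriorPower.map_apply_ιMulti]
  congr 1
  ext i
  fin_cases i <;> rfl

/-- The `SO(3,1)`-orbit `𝓛(Ω)` through `Ω`. -/
def orbit (Ω : Bivec) : Set Bivec := {Θ | ∃ P ∈ SO31, Θ = tilde P Ω}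

/-- `(e₁, e₂, e₃, e₄)` is an ordered pseudo-orthonormal basis with `e₁, e₂, e₃` space-like and
`e₄` time-like that gives the orientation. -/
structure IsPseudoOrthonormal (e : Module.Basis (Fin 4) ℝ E41) : Prop where
  metric : ∀ i j, hMink (e i) (e j) = if i = j then sgn i else 0
  orientation : 0 < (Pi.basisFun ℝ (Fin 4)).det e

section Frame

variable (e : Module.Basis (Fin 4) ℝ E41)

/-- `ω_{ij} = e_i ∧ e_j`, with indices from `0` to `3`. -/
def om (i j : Fin 4) : Bivec := wedge (e i) (e j)

/-- `E_{±,1} = (ω₁₂ ± ω₃₄)/√2`, where `s = ±1` is the sign. -/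
def E1 (s : ℝ) : Bivec := (1 / √2) • (om e 0 1 + s • om e 2 3)

/-- `E_{±,2} = (ω₁₃ ± ω₄₂)/√2`. -/
def E2 (s : ℝ) : Bivec := (1 / √2) • (om e 0 2 + s • om e 3 1)

/-- `E_{±,3} = (ω₁₄ ± ω₂₃)/√2`. -/
def E3 (s : ℝ) : Bivec := (1 / √2) • (om e 0 3 + s • om e 1 2)

/-- `Ω = √2 (cos φ ω₁₂ + sin φ ω₂₃ + ω₃₄)`. -/
def Om (φ : ℝ) : Bivec :=
  √2 • (Real.cos φ • om e 0 1 + Real.sin φ • om e 1 2 + om e 2 3)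

/-- `X_± = sin φ E_{±,1} ∓ cos φ E_{±,3} - E_{∓,3}`. -/
def Xpm (φ s : ℝ) : Bivec :=
  Real.sin φ • E1 e s - (s * Real.cos φ) • E3 e s - E3 e (-s)

/-- `Y_± = E_{±,2}`. -/
def Ypm (s : ℝ) : Bivec := E2 e s

/-- The rotation `P_{2,1}` by the angle `θ` in the plane of `e₁, e₃`. -/
def P21 (θ : ℝ) : E41 →ₗ[ℝ] E41 :=
  Matrix.toLin e e
    !![Real.cos θ, 0, -Real.sin θ, 0;
       0, 1, 0, 0;
       Real.sin θ, 0, Real.cos θ, 0;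
       0, 0, 0, 1]

/-- The boost `P_{2,2}` with parameter `t` in the plane of `e₂, e₄`. -/
def P22 (t : ℝ) : E41 →ₗ[ℝ] E41 :=
  Matrix.toLin e e
    !![1, 0, 0, 0;
       0, Real.cosh t, 0, Real.sinh t;
       0, 0, 1, 0;
       0, Real.sinh t, 0, Real.cosh t]

/-- `T̃_P ∘ T̃_{P_{2,1}} ∘ T̃_{P_{2,2}}`, with parameters `θ` and `t` in the last two. -/
def sweep (P : E41 →ₗ[ℝ] E41) (θ t : ℝ) : Bivec →ₗ[ℝ] Bivec :=
  tilde P ∘ₗ tilde (P21 e θ) ∘ₗ tilde (P22 e t)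

end Frame

/-! ## Distributions on a submanifold `L` of `⋀² E`, and their integral surfaces -/

/-- The tangent space of `L` at `Θ`: the velocities at `Θ` of the smooth curves in `L`
(for a submanifold they already form a linear subspace). -/
def tangentSpaceAt (L : Set Bivec) (Θ : Bivec) : Submodule ℝ Bivec :=
  Submodule.span ℝ {v | ∃ γ : ℝ → Bivec,
    ContDiff ℝ ∞ γ ∧ (∀ s, γ s ∈ L) ∧ γ 0 = Θ ∧ deriv γ 0 = v}

/-- `D` is a smooth distribution of rank `k` on `L` (its values outside `L` are irrelevant). -/
structure IsDistribution (L : Set Bivec) (D : Bivec → Submodule ℝ Bivec) (k : ℕ) : Prop where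
  le_tangent : ∀ Θ ∈ L, D Θ ≤ tangentSpaceAt L Θ
  rank : ∀ Θ ∈ L, Module.finrank ℝ (D Θ) = k
  smooth : ∀ Θ₀ ∈ L, ∃ U : Set Bivec, IsOpen U ∧ Θ₀ ∈ U ∧
    ∃ Z : Fin k → Bivec → Bivec, (∀ i, ContDiffOn ℝ ∞ (Z i) U) ∧
      ∀ Θ ∈ L ∩ U, D Θ = Submodule.span ℝ (range fun i => Z i Θ)

/-- `D` is involutive on `L`: the bracket of two local smooth sections of `D` is a section of `D`.
Local vector fields on `L` are given by smooth extensions to open sets of the ambient space; on `L`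
the bracket of fields tangent to `L` does not depend on the extensions. -/
def IsInvolutive (L : Set Bivec) (D : Bivec → Submodule ℝ Bivec) : Prop :=
  ∀ U : Set Bivec, IsOpen U → ∀ V W : Bivec → Bivec,
    ContDiffOn ℝ ∞ V U → ContDiffOn ℝ ∞ W U →
    (∀ Θ ∈ L ∩ U, V Θ ∈ D Θ) → (∀ Θ ∈ L ∩ U, W Θ ∈ D Θ) →
    ∀ Θ ∈ L ∩ U, VectorField.lieBracket ℝ V W Θ ∈ D Θ

/-- The model plane for surfaces. -/
abbrev Plane : Type := EuclideanSpace ℝ (Fin 2)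

/-- `F : M → ⋀² E` presents the connected surface `M` as an (immersed) integral surface in `L`
of `D`. -/
structure IsIntegralSurface (L : Set Bivec) (D : Bivec → Submodule ℝ Bivec)
    {M : Type*} [TopologicalSpace M] [ChartedSpace Plane M] (F : M → Bivec) : Prop where
  connected : ConnectedSpace M
  smooth : ContMDiff (𝓡 2) 𝓘(ℝ, Bivec) ∞ F
  mem : ∀ p, F p ∈ L
  immersion : ∀ p, Function.Injective (mfderiv (𝓡 2) 𝓘(ℝ, Bivec) F p)
  tangent : ∀ p, LinearMap.range (mfderiv (𝓡 2) 𝓘(ℝ, Bivec) F p).toLinearMap = D (F p)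

/-- The covariant derivative at `p`, along the tangent vector `v` of the surface `M`, of a vector
field `Z` along `M` with values in `⋀² E`, for the Levi-Civita connection of the flat metric `ĥ`. -/
def covDeriv {M : Type*} [TopologicalSpace M] [ChartedSpace Plane M]
    (Z : M → Bivec) (p : M) (v : TangentSpace (𝓡 2) p) : Bivec :=
  mfderiv (𝓡 2) 𝓘(ℝ, Bivec) Z p v

/-- `Z` is the vector field along `F : M → ⋀² E` obtained by transporting `W` from `Ω`: its value
at `T̃_P T̃_{P_{2,1}} T̃_{P_{2,2}} Ω` is `T̃_P T̃_{P_{2,1}} T̃_{P_{2,2}} W`. -/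
def IsTransported (e : Module.Basis (Fin 4) ℝ E41) (P : E41 →ₗ[ℝ] E41) (Ω : Bivec)
    {M : Type*} (F : M → Bivec) (W : Bivec) (Z : M → Bivec) : Prop :=
  ∀ p θ t, F p = sweep e P θ t Ω → Z p = sweep e P θ t W

end MinkowskiBivector

end

open MinkowskiBivector
open scoped Manifold ContDiff

/-!
For `φ = π/2` the bivector `Ω = √2 (e₂ - e₄) ∧ e₃` is decomposable and null: `ĥ(Ω, Ω) = 0` and
`ĥ(Ω, *Ω) = 0`, where `*` is the Hodge star. In Lorentzian signature `* ∘ * = -1`, so `*` makes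
`⋀² E` a complex vector space of dimension three, and `SO(3,1)` acts complex linearly
(`hodge_tilde`) because `ĥ(α, *β)` is the volume of `α ∧ β`. The orbit of `Ω` thus lies in the cone
of complex null vectors, and the distribution is `Θ ↦ span (Θ, *Θ)`, the complex line through `Θ`
(`hodgeLine`).

* Radical (`mem_hodgeLine_iff_radical`): differentiating `ĥ(Θ, Θ) = ĥ(Θ, *Θ) = 0` shows that the
  tangent space is orthogonal to `Θ` and `*Θ`; it also contains two vectors whose orthogonality
  leaves only the complex line.
* Involutivity (`isInvolutive_hodgeLine`): on the punctured complex line through `Θ` a section takes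
  values in that one line, hence so do its derivatives along the line.
* The boosts `P_{2,2}` scale `Ω` and the rotations `P_{2,1}` multiply it by unit complex numbers, so
  `(θ, t) ↦ T̃_P T̃_{P_{2,1}} T̃_{P_{2,2}} Ω` is polar coordinates on a punctured complex line
  (`sweep_Om`).
* Uniqueness (`mem_hodgeLine_of_isIntegralSurface`): along an integral surface the derivative of
  the position is a complex multiple of the position, so quotients of complex coordinates are
  locally constant, and a connected surface stays in one complex line.
* Transported fields: `X_± = (± Ω + *Ω) / 2`, so `X̃_±` is a complex linear function of the position
  and its derivatives lie in the complex line, which is tangent to the surface and totally null.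
  The bivectors `Y_±` are fixed by the rotations and the boosts, so `Ỹ_±` is constant.
-/

noncomputable section

namespace MinkowskiBivector

open scoped Manifold ContDiff
open Set

/-! ### Bivectors in a pseudo-orthonormal frame -/

theorem wedge_add_left (x x' y : E41) : wedge (x + x') y = wedge x y + wedge x' y :=
  (exteriorPower.ιMulti ℝ 2 (M := E41)).toMultilinearMap.cons_add ![y] x x'

theorem wedge_smul_left (c : ℝ) (x y : E41) : wedge (c • x) y = c • wedge x y :=
  (exteriorPower.ιMulti ℝ 2 (M := E41)).toMultilinearMap.cons_smul ![y] c x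

theorem wedge_self (x : E41) : wedge x x = 0 :=
  (exteriorPower.ιMulti ℝ 2 (M := E41)).map_eq_zero_of_eq ![x, x] (i := 0) (j := 1) rfl
    (by decide)

theorem wedge_swap (x y : E41) : wedge x y = -wedge y x := by
  have h := (exteriorPower.ιMulti ℝ 2 (M := E41)).map_swap ![y, x] (i := 0) (j := 1) (by decide)
  rw [wedge, wedge, ← h]
  congr 1
  ext i
  fin_cases i <;> rfl

theorem wedge_add_right (x y y' : E41) : wedge x (y + y') = wedge x y + wedge x y' := by
  rw [wedge_swap, wedge_add_left, wedge_swap y, wedge_swap y']; abel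

theorem wedge_smul_right (c : ℝ) (x y : E41) : wedge x (c • y) = c • wedge x y := by
  rw [wedge_swap, wedge_smul_left, wedge_swap y, smul_neg, neg_neg]

theorem wedge_neg_left (x y : E41) : wedge (-x) y = -wedge x y := by
  simpa using wedge_smul_left (-1) x y

theorem wedge_neg_right (x y : E41) : wedge x (-y) = -wedge x y := by
  simpa using wedge_smul_right (-1) x y

theorem linearMap_ext_wedge {N : Type*} [AddCommGroup N] [Module ℝ N] {f g : Bivec →ₗ[ℝ] N}
    (h : ∀ x y, f (wedge x y) = g (wedge x y)) : f = g := by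
  refine exteriorPower.linearMap_ext (AlternatingMap.ext fun m => ?_)
  have hm : m = ![m 0, m 1] := by
    ext i
    fin_cases i <;> rfl
  rw [hm]
  exact h _ _

section Frame

variable {e : Module.Basis (Fin 4) ℝ E41}

theorem wedge_eq_frame (x y : E41) :
    wedge x y =
      (e.repr x 0 * e.repr y 1 - e.repr x 1 * e.repr y 0) • om e 0 1
      + (e.repr x 0 * e.repr y 2 - e.repr x 2 * e.repr y 0) • om e 0 2
      + (e.repr x 0 * e.repr y 3 - e.repr x 3 * e.repr y 0) • om e 0 3
      + (e.repr x 1 * e.repr y 2 - e.repr x 2 * e.repr y 1) • om e 1 2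
      + (e.repr x 1 * e.repr y 3 - e.repr x 3 * e.repr y 1) • om e 1 3
      + (e.repr x 2 * e.repr y 3 - e.repr x 3 * e.repr y 2) • om e 2 3 := by
  have hx := e.sum_repr x
  have hy := e.sum_repr y
  rw [Fin.sum_univ_four] at hx hy
  conv_lhs => rw [← hx, ← hy]
  simp only [wedge_add_left, wedge_add_right, wedge_smul_left, wedge_smul_right, wedge_self]
  simp only [om]
  rw [wedge_swap (e 1) (e 0), wedge_swap (e 2) (e 0), wedge_swap (e 3) (e 0),
    wedge_swap (e 2) (e 1), wedge_swap (e 3) (e 1), wedge_swap (e 3) (e 2)]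
  module

theorem hMink_eq_frame (he : IsPseudoOrthonormal e) (x y : E41) :
    hMink x y = e.repr x 0 * e.repr y 0 + e.repr x 1 * e.repr y 1 + e.repr x 2 * e.repr y 2
      - e.repr x 3 * e.repr y 3 := by
  have hx := e.sum_repr x
  have hy := e.sum_repr y
  rw [Fin.sum_univ_four] at hx hy
  conv_lhs => rw [← hx, ← hy]
  simp [he.metric, sgn]
  ring

variable (e) in
/-- The coefficient of `ω_{ij}` of a bivector in the frame `e`, read off with the metric `ĥ`. -/
def coef (i j : Fin 4) : Bivec →ₗ[ℝ] ℝ := (sgn i * sgn j) • LinearMap.flip hHat (om e i j)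

theorem coef_wedge (he : IsPseudoOrthonormal e) {i j : Fin 4} (x y : E41) :
    coef e i j (wedge x y) = e.repr x i * e.repr y j - e.repr x j * e.repr y i := by
  simp only [coef, om, LinearMap.smul_apply, LinearMap.flip_apply, hHat_wedge, smul_eq_mul]
  have h : ∀ (z : E41) (k : Fin 4), hMink z (e k) = sgn k * e.repr z k := by
    intro z k
    rw [hMink_eq_frame he]
    fin_cases k <;> simp [sgn]
  have hs : ∀ k, sgn k * sgn k = 1 := by
    intro k
    fin_cases k <;> simp [sgn]
  simp only [h]
  linear_combination (e.repr x i * e.repr y j - e.repr x j * e.repr y i) *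
    (hs i * sgn j * sgn j + hs j)

theorem coef_om (he : IsPseudoOrthonormal e) (i j k l : Fin 4) :
    coef e i j (om e k l) = (if k = i then 1 else 0) * (if l = j then 1 else 0)
      - (if k = j then 1 else 0) * (if l = i then 1 else 0) := by
  rw [om, coef_wedge he]
  simp [Finsupp.single_apply]

theorem eq_frame (he : IsPseudoOrthonormal e) (v : Bivec) :
    v = coef e 0 1 v • om e 0 1 + coef e 0 2 v • om e 0 2 + coef e 0 3 v • om e 0 3
      + coef e 1 2 v • om e 1 2 + coef e 1 3 v • om e 1 3 + coef e 2 3 v • om e 2 3 := by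
  have h : LinearMap.id = (coef e 0 1).smulRight (om e 0 1) + (coef e 0 2).smulRight (om e 0 2)
      + (coef e 0 3).smulRight (om e 0 3) + (coef e 1 2).smulRight (om e 1 2)
      + (coef e 1 3).smulRight (om e 1 3) + (coef e 2 3).smulRight (om e 2 3) := by
    refine linearMap_ext_wedge fun x y => ?_
    simp only [LinearMap.add_apply, LinearMap.smulRight_apply, coef_wedge he, LinearMap.id_apply]
    exact wedge_eq_frame x y
  exact LinearMap.congr_fun h v

theorem hHat_eq_frame (he : IsPseudoOrthonormal e) (v w : Bivec) :
    hHat v w = coef e 0 1 v * coef e 0 1 w + coef e 0 2 v * coef e 0 2 w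
      - coef e 0 3 v * coef e 0 3 w + coef e 1 2 v * coef e 1 2 w
      - coef e 1 3 v * coef e 1 3 w - coef e 2 3 v * coef e 2 3 w := by
  conv_lhs => rw [eq_frame he w]
  simp [coef, sgn]
  ring

theorem hHat_comm (he : IsPseudoOrthonormal e) (v w : Bivec) : hHat v w = hHat w v := by
  rw [hHat_eq_frame he, hHat_eq_frame he]; ring

theorem eq_of_coef_eq (he : IsPseudoOrthonormal e) {v w : Bivec}
    (h01 : coef e 0 1 v = coef e 0 1 w) (h02 : coef e 0 2 v = coef e 0 2 w)
    (h03 : coef e 0 3 v = coef e 0 3 w) (h12 : coef e 1 2 v = coef e 1 2 w)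
    (h13 : coef e 1 3 v = coef e 1 3 w) (h23 : coef e 2 3 v = coef e 2 3 w) : v = w := by
  rw [eq_frame he v, eq_frame he w, h01, h02, h03, h12, h13, h23]

theorem eq_of_hHat_eq (he : IsPseudoOrthonormal e) {v w : Bivec}
    (h : ∀ u, hHat u v = hHat u w) : v = w := by
  have hc : ∀ i j, coef e i j v = coef e i j w := by
    intro i j
    simp only [coef, LinearMap.smul_apply, LinearMap.flip_apply]
    rw [hHat_comm he v, hHat_comm he w, h]
  exact eq_of_coef_eq he (hc _ _) (hc _ _) (hc _ _) (hc _ _) (hc _ _) (hc _ _)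

/-! ### The Hodge star as a complex structure -/

variable (e) in
/-- The Hodge star of `⋀² E` for the volume form of the frame `e`, with the sign convention
`ĥ(α, *β) = vol(α ∧ β)`. -/
def hodge : Bivec →ₗ[ℝ] Bivec :=
  (coef e 2 3).smulRight (om e 0 1) - (coef e 1 3).smulRight (om e 0 2)
  - (coef e 1 2).smulRight (om e 0 3) + (coef e 0 3).smulRight (om e 1 2)
  + (coef e 0 2).smulRight (om e 1 3) - (coef e 0 1).smulRight (om e 2 3)

theorem coef_hodge (he : IsPseudoOrthonormal e) (v : Bivec) :
    coef e 0 1 (hodge e v) = coef e 2 3 v ∧ coef e 0 2 (hodge e v) = -coef e 1 3 v ∧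
    coef e 0 3 (hodge e v) = -coef e 1 2 v ∧ coef e 1 2 (hodge e v) = coef e 0 3 v ∧
    coef e 1 3 (hodge e v) = coef e 0 2 v ∧ coef e 2 3 (hodge e v) = -coef e 0 1 v := by
  simp [hodge, coef_om he]

theorem hodge_hodge (he : IsPseudoOrthonormal e) (v : Bivec) : hodge e (hodge e v) = -v := by
  obtain ⟨h1, h2, h3, h4, h5, h6⟩ := coef_hodge he v
  obtain ⟨k1, k2, k3, k4, k5, k6⟩ := coef_hodge he (hodge e v)
  apply eq_of_coef_eq he <;> simp [*]

theorem hHat_hodge_hodge (he : IsPseudoOrthonormal e) (v w : Bivec) :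
    hHat (hodge e v) (hodge e w) = -hHat v w := by
  obtain ⟨h1, h2, h3, h4, h5, h6⟩ := coef_hodge he v
  obtain ⟨k1, k2, k3, k4, k5, k6⟩ := coef_hodge he w
  rw [hHat_eq_frame he, hHat_eq_frame he v, h1, h2, h3, h4, h5, h6, k1, k2, k3, k4, k5, k6]
  ring

theorem hHat_hodge_left (he : IsPseudoOrthonormal e) (v w : Bivec) :
    hHat (hodge e v) w = hHat v (hodge e w) := by
  have h := hHat_hodge_hodge he v (hodge e w)
  rw [hodge_hodge he, map_neg] at h
  linarith

/-- The relation `ĥ(α, *β) = vol(α ∧ β)` for decomposable bivectors. -/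
theorem hHat_wedge_hodge_wedge (he : IsPseudoOrthonormal e) (x y u v : E41) :
    hHat (wedge x y) (hodge e (wedge u v)) = e.det ![x, y, u, v] := by
  obtain ⟨h1, h2, h3, h4, h5, h6⟩ := coef_hodge he (wedge u v)
  rw [hHat_eq_frame he, h1, h2, h3, h4, h5, h6, Module.Basis.det_apply]
  simp only [coef_wedge he, Matrix.det_succ_row_zero, Module.Basis.toMatrix_apply,
    Fin.sum_univ_succ, Matrix.det_fin_zero]
  simp [Module.Basis.toMatrix_apply, Fin.succAbove]
  ring

theorem hHat_tilde {P : E41 →ₗ[ℝ] E41} (hP : P ∈ SO31) (v w : Bivec) :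
    hHat (tilde P v) (tilde P w) = hHat v w := by
  have h : (hHat.compl₁₂ (tilde P) (tilde P) : LinearMap.BilinForm ℝ Bivec) = hHat := by
    refine linearMap_ext_wedge fun x y => linearMap_ext_wedge fun u v => ?_
    simp only [LinearMap.compl₁₂_apply, tilde_wedge, hHat_wedge, hP.1]
  exact LinearMap.congr_fun₂ h v w

theorem tilde_comp (P Q : E41 →ₗ[ℝ] E41) : tilde (P ∘ₗ Q) = tilde P ∘ₗ tilde Q :=
  exteriorPower.map_comp _ _

theorem comp_mem_SO31 {P Q : E41 →ₗ[ℝ] E41} (hP : P ∈ SO31) (hQ : Q ∈ SO31) : P ∘ₗ Q ∈ SO31 :=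
  ⟨fun x y => by simp [hP.1, hQ.1], by rw [LinearMap.det_comp, hP.2, hQ.2, one_mul]⟩

theorem exists_inverse_mem_SO31 {P : E41 →ₗ[ℝ] E41} (hP : P ∈ SO31) :
    ∃ Q ∈ SO31, P ∘ₗ Q = LinearMap.id ∧ Q ∘ₗ P = LinearMap.id := by
  have hu : IsUnit (LinearMap.det P) := by rw [hP.2]; exact isUnit_one
  let Q := LinearMap.equivOfIsUnitDet hu
  have hQP : Q.toLinearMap = P := LinearMap.coe_equivOfIsUnitDet hu
  have hQ : ∀ x, P (Q.symm x) = x := fun x => by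
    conv_lhs => rw [← hQP]
    exact Q.apply_symm_apply x
  have h1 : P ∘ₗ Q.symm.toLinearMap = LinearMap.id := LinearMap.ext hQ
  refine ⟨Q.symm.toLinearMap, ⟨fun x y => ?_, ?_⟩, h1,
    by rw [← hQP]; exact LinearMap.ext fun x => Q.symm_apply_apply x⟩
  · conv_rhs => rw [← hQ x, ← hQ y, hP.1]
    rfl
  · have h := congrArg LinearMap.det h1
    rwa [LinearMap.det_comp, hP.2, one_mul, LinearMap.det_id] at h

theorem tilde_id : tilde LinearMap.id = LinearMap.id := exteriorPower.map_id

/-- The Hodge star commutes with `SO(3,1)`. -/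
theorem hodge_tilde (he : IsPseudoOrthonormal e) {P : E41 →ₗ[ℝ] E41} (hP : P ∈ SO31) (w : Bivec) :
    hodge e (tilde P w) = tilde P (hodge e w) := by
  -- Both sides have the same `ĥ`-product with every `T̃_P v`, because `ĥ(v, *w)` is given by a
  -- determinant, and `T̃_P` is onto.
  have h : hHat.compl₁₂ (tilde P) (hodge e ∘ₗ tilde P) = hHat.compl₁₂ LinearMap.id (hodge e) := by
    refine linearMap_ext_wedge fun x y => linearMap_ext_wedge fun u v => ?_
    simp only [LinearMap.compl₁₂_apply, LinearMap.comp_apply, tilde_wedge,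
      hHat_wedge_hodge_wedge he, LinearMap.id_apply]
    have hd := e.det_comp P ![x, y, u, v]
    rw [hP.2, one_mul] at hd
    rw [← hd]
    congr 1
    ext i
    fin_cases i <;> rfl
  obtain ⟨Q, -, hPQ, -⟩ := exists_inverse_mem_SO31 hP
  refine eq_of_hHat_eq he fun v => ?_
  have hv : v = tilde P (tilde Q v) := by
    rw [← LinearMap.comp_apply, ← tilde_comp, hPQ, tilde_id, LinearMap.id_apply]
  rw [hv, hHat_tilde hP]
  exact LinearMap.congr_fun₂ h (tilde Q v) w

/-! ### Frame rotations and boosts -/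

theorem toLin_mem_SO31 (he : IsPseudoOrthonormal e) {A : Matrix (Fin 4) (Fin 4) ℝ}
    (hA : A.transpose * Matrix.diagonal sgn * A = Matrix.diagonal sgn) (hdet : A.det = 1) :
    Matrix.toLin e e A ∈ SO31 := by
  refine ⟨fun x y => ?_, by rw [LinearMap.det_toLin, hdet]⟩
  have hm : ∀ x y, hMink x y = e.repr x ⬝ᵥ (Matrix.diagonal sgn).mulVec (e.repr y) := by
    intro x y
    rw [hMink_eq_frame he]
    simp [Matrix.mulVec_diagonal, dotProduct, Fin.sum_univ_four, sgn]
    ring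
  have hr : ∀ x, ⇑(e.repr (Matrix.toLin e e A x)) = A.mulVec (e.repr x) := by
    intro x
    rw [← LinearMap.toMatrix_mulVec_repr e e, LinearMap.toMatrix_toLin]
  rw [hm, hm, hr, hr, ← Matrix.vecMul_transpose, ← Matrix.dotProduct_mulVec,
    Matrix.mulVec_mulVec, Matrix.mulVec_mulVec, hA]

theorem diagonal_sgn :
    Matrix.diagonal sgn = !![1, 0, 0, 0; 0, 1, 0, 0; 0, 0, 1, 0; 0, 0, 0, -1] := by
  ext i j
  fin_cases i <;> fin_cases j <;> simp [sgn]

theorem P21_mem_SO31 (he : IsPseudoOrthonormal e) (θ : ℝ) : P21 e θ ∈ SO31 := by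
  have h := Real.cos_sq_add_sin_sq θ
  refine toLin_mem_SO31 he ?_ ?_
  · rw [diagonal_sgn]
    ext i j
    fin_cases i <;> fin_cases j <;> simp [Matrix.mul_apply, Fin.sum_univ_four] <;>
      linarith
  · simp [Matrix.det_succ_row_zero, Fin.sum_univ_succ, Fin.succAbove]
    linarith

theorem P22_mem_SO31 (he : IsPseudoOrthonormal e) (t : ℝ) : P22 e t ∈ SO31 := by
  have h := Real.cosh_sq_sub_sinh_sq t
  refine toLin_mem_SO31 he ?_ ?_
  · rw [diagonal_sgn]
    ext i j
    fin_cases i <;> fin_cases j <;> simp [Matrix.mul_apply, Fin.sum_univ_four] <;>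
      linarith
  · simp [Matrix.det_succ_row_zero, Fin.sum_univ_succ, Fin.succAbove]
    linarith

variable (e) in
/-- The rotation by the angle `s` in the plane of `e₁, e₂`. -/
def rot01 (s : ℝ) : E41 →ₗ[ℝ] E41 :=
  Matrix.toLin e e
    !![Real.cos s, -Real.sin s, 0, 0;
       Real.sin s, Real.cos s, 0, 0;
       0, 0, 1, 0;
       0, 0, 0, 1]

variable (e) in
/-- The rotation by the angle `s` in the plane of `e₂, e₃`. -/
def rot12 (s : ℝ) : E41 →ₗ[ℝ] E41 :=
  Matrix.toLin e e
    !![1, 0, 0, 0;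
       0, Real.cos s, -Real.sin s, 0;
       0, Real.sin s, Real.cos s, 0;
       0, 0, 0, 1]

theorem rot01_mem_SO31 (he : IsPseudoOrthonormal e) (s : ℝ) : rot01 e s ∈ SO31 := by
  have h := Real.cos_sq_add_sin_sq s
  refine toLin_mem_SO31 he ?_ ?_
  · rw [diagonal_sgn]
    ext i j
    fin_cases i <;> fin_cases j <;> simp [Matrix.mul_apply, Fin.sum_univ_four] <;>
      linarith
  · simp [Matrix.det_succ_row_zero, Fin.sum_univ_succ, Fin.succAbove]
    linarith

theorem rot12_mem_SO31 (he : IsPseudoOrthonormal e) (s : ℝ) : rot12 e s ∈ SO31 := by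
  have h := Real.cos_sq_add_sin_sq s
  refine toLin_mem_SO31 he ?_ ?_
  · rw [diagonal_sgn]
    ext i j
    fin_cases i <;> fin_cases j <;> simp [Matrix.mul_apply, Fin.sum_univ_four] <;>
      linarith
  · simp [Matrix.det_succ_row_zero, Fin.sum_univ_succ, Fin.succAbove]
    linarith

/-! ### The null bivector and its orbit -/

/-- For `φ = π/2` the bivector `Ω` is `√2 (e₂ - e₄) ∧ e₃`, with the null vector `e₂ - e₄`. -/
theorem Om_pi_div_two : Om e (Real.pi / 2) = √2 • (om e 1 2 + om e 2 3) := by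
  simp [Om]

theorem coef_Om (he : IsPseudoOrthonormal e) :
    coef e 0 1 (Om e (Real.pi / 2)) = 0 ∧ coef e 0 2 (Om e (Real.pi / 2)) = 0 ∧
    coef e 0 3 (Om e (Real.pi / 2)) = 0 ∧ coef e 1 2 (Om e (Real.pi / 2)) = √2 ∧
    coef e 1 3 (Om e (Real.pi / 2)) = 0 ∧ coef e 2 3 (Om e (Real.pi / 2)) = √2 := by
  simp [Om_pi_div_two, coef_om he]

theorem Om_ne_zero (he : IsPseudoOrthonormal e) : Om e (Real.pi / 2) ≠ 0 := by
  intro h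
  have h2 := (coef_Om he).2.2.2.1
  rw [h, map_zero] at h2
  have : √(2 : ℝ) ≠ 0 := by positivity
  exact this h2.symm

theorem hodge_Om (he : IsPseudoOrthonormal e) :
    hodge e (Om e (Real.pi / 2)) = √2 • (om e 0 1 - om e 0 3) := by
  obtain ⟨h1, h2, h3, h4, h5, h6⟩ := coef_Om he
  simp [hodge, h1, h2, h3, h4, h5, h6, smul_sub]

theorem hHat_Om_self (he : IsPseudoOrthonormal e) :
    hHat (Om e (Real.pi / 2)) (Om e (Real.pi / 2)) = 0 ∧
    hHat (Om e (Real.pi / 2)) (hodge e (Om e (Real.pi / 2))) = 0 := by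
  obtain ⟨h1, h2, h3, h4, h5, h6⟩ := coef_Om he
  obtain ⟨k1, k2, k3, k4, k5, k6⟩ := coef_hodge he (Om e (Real.pi / 2))
  rw [hHat_eq_frame he, hHat_eq_frame he, k1, k2, k3, k4, k5, k6, h1, h2, h3, h4, h5, h6]
  constructor <;> ring

/-- The vector `X_±` lies in the complex line through `Ω`, so that the fields transported from it
are the position vector multiplied by the complex number `(s + i) / 2`. -/
theorem Xpm_eq (he : IsPseudoOrthonormal e) (s : ℝ) :
    Xpm e (Real.pi / 2) s =
      (1 / 2 : ℝ) • (s • Om e (Real.pi / 2) + hodge e (Om e (Real.pi / 2))) := by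
  have h2 : (1 / √2 : ℝ) = (1 / 2) * √2 := by
    have := Real.mul_self_sqrt (show (0 : ℝ) ≤ 2 by norm_num)
    field_simp
    linarith
  rw [hodge_Om he, Om_pi_div_two, Xpm, E1, E3, E3, Real.sin_pi_div_two, Real.cos_pi_div_two, h2]
  module

/-- The boosts scale `Ω`, as they scale the null vector `e₂ - e₄`. -/
theorem tilde_P22_Om (t : ℝ) :
    tilde (P22 e t) (Om e (Real.pi / 2)) = Real.exp (-t) • Om e (Real.pi / 2) := by
  rw [Om_pi_div_two]
  simp only [om, map_smul, map_add, tilde_wedge, P22, Matrix.toLin_self, Fin.sum_univ_four]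
  simp [wedge_add_left, wedge_add_right, wedge_smul_left, wedge_smul_right]
  rw [wedge_swap (e 3) (e 2), wedge_swap (e 2) (e 1), ← Real.cosh_sub_sinh]
  module

/-- The rotations act on `Ω` as the unit complex numbers for the complex structure `*`. -/
theorem tilde_P21_Om (he : IsPseudoOrthonormal e) (θ : ℝ) :
    tilde (P21 e θ) (Om e (Real.pi / 2)) =
      Real.cos θ • Om e (Real.pi / 2) + Real.sin θ • hodge e (Om e (Real.pi / 2)) := by
  rw [hodge_Om he, Om_pi_div_two]
  simp only [om, map_smul, map_add, tilde_wedge, P21, Matrix.toLin_self, Fin.sum_univ_four]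
  simp [wedge_add_left, wedge_add_right, wedge_smul_left, wedge_smul_right, wedge_neg_left,
    wedge_neg_right]
  rw [wedge_swap (e 1) (e 0)]
  module

theorem tilde_rot01_Om (s : ℝ) :
    tilde (rot01 e s) (Om e (Real.pi / 2)) =
      √2 • (Real.cos s • om e 1 2 - Real.sin s • om e 0 2 + om e 2 3) := by
  rw [Om_pi_div_two]
  simp only [om, map_smul, map_add, tilde_wedge, rot01, Matrix.toLin_self, Fin.sum_univ_four]
  simp [wedge_add_left, wedge_smul_left, wedge_neg_left]
  module

theorem tilde_rot12_Om (s : ℝ) :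
    tilde (rot12 e s) (Om e (Real.pi / 2)) =
      √2 • (om e 1 2 + Real.cos s • om e 2 3 - Real.sin s • om e 1 3) := by
  have h := Real.cos_sq_add_sin_sq s
  rw [Om_pi_div_two]
  simp only [om, map_smul, map_add, tilde_wedge, rot12, Matrix.toLin_self, Fin.sum_univ_four]
  simp [wedge_add_left, wedge_add_right, wedge_smul_left, wedge_smul_right, wedge_neg_left,
    wedge_neg_right, wedge_self]
  rw [wedge_swap (e 2) (e 1)]
  have h' : wedge (e 1) (e 2) =
      (Real.cos s ^ 2 + Real.sin s ^ 2) • wedge (e 1) (e 2) := by rw [h, one_smul]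
  conv_rhs => rw [h']
  module

theorem tilde_P21_Ypm (θ s : ℝ) : tilde (P21 e θ) (Ypm e s) = Ypm e s := by
  have h := Real.cos_sq_add_sin_sq θ
  rw [Ypm, E2]
  simp only [om, map_smul, map_add, tilde_wedge, P21, Matrix.toLin_self, Fin.sum_univ_four]
  simp [wedge_add_left, wedge_add_right, wedge_smul_left, wedge_smul_right,
    wedge_neg_right, wedge_self]
  rw [wedge_swap (e 2) (e 0)]
  have h' : wedge (e 0) (e 2) =
      (Real.cos θ ^ 2 + Real.sin θ ^ 2) • wedge (e 0) (e 2) := by rw [h, one_smul]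
  conv_rhs => rw [h']
  module

theorem tilde_P22_Ypm (t s : ℝ) : tilde (P22 e t) (Ypm e s) = Ypm e s := by
  have h := Real.cosh_sq_sub_sinh_sq t
  rw [Ypm, E2]
  simp only [om, map_smul, map_add, tilde_wedge, P22, Matrix.toLin_self, Fin.sum_univ_four]
  simp [wedge_add_left, wedge_add_right, wedge_smul_left, wedge_smul_right, wedge_self]
  rw [wedge_swap (e 1) (e 3)]
  have h' : wedge (e 3) (e 1) =
      (Real.cosh t ^ 2 - Real.sinh t ^ 2) • wedge (e 3) (e 1) := by rw [h, one_smul]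
  conv_rhs => rw [h']
  module

theorem sweep_Ypm (P : E41 →ₗ[ℝ] E41) (θ t s : ℝ) :
    sweep e P θ t (Ypm e s) = tilde P (Ypm e s) := by
  simp [sweep, tilde_P22_Ypm, tilde_P21_Ypm]

/-- The swept surface is the punctured complex line through `T̃_P Ω` in polar coordinates of radius
`exp (-t)` and angle `θ`. -/
theorem sweep_Om (he : IsPseudoOrthonormal e) {P : E41 →ₗ[ℝ] E41} (hP : P ∈ SO31) (θ t : ℝ) :
    sweep e P θ t (Om e (Real.pi / 2)) =
      (Real.exp (-t) * Real.cos θ) • tilde P (Om e (Real.pi / 2)) +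
      (Real.exp (-t) * Real.sin θ) • hodge e (tilde P (Om e (Real.pi / 2))) := by
  simp only [sweep, LinearMap.comp_apply, tilde_P22_Om, map_smul, tilde_P21_Om he, map_add,
    hodge_tilde he hP]
  module

theorem sweep_Xpm (he : IsPseudoOrthonormal e) {P : E41 →ₗ[ℝ] E41} (hP : P ∈ SO31)
    (θ t s : ℝ) :
    sweep e P θ t (Xpm e (Real.pi / 2) s) =
      (1 / 2 : ℝ) • (s • sweep e P θ t (Om e (Real.pi / 2)) +
        hodge e (sweep e P θ t (Om e (Real.pi / 2)))) := by
  simp only [Xpm_eq he, sweep, LinearMap.comp_apply, map_smul, map_add,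
    hodge_tilde he hP, hodge_tilde he (P21_mem_SO31 he θ), hodge_tilde he (P22_mem_SO31 he t)]

theorem sweep_Om_mem_orbit (he : IsPseudoOrthonormal e) {P : E41 →ₗ[ℝ] E41} (hP : P ∈ SO31)
    (θ t : ℝ) : sweep e P θ t (Om e (Real.pi / 2)) ∈ orbit (Om e (Real.pi / 2)) := by
  refine ⟨P ∘ₗ P21 e θ ∘ₗ P22 e t,
    comp_mem_SO31 hP (comp_mem_SO31 (P21_mem_SO31 he θ) (P22_mem_SO31 he t)), ?_⟩
  simp [sweep, tilde_comp]

theorem ne_zero_of_mem_orbit (he : IsPseudoOrthonormal e) {Θ : Bivec}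
    (hΘ : Θ ∈ orbit (Om e (Real.pi / 2))) : Θ ≠ 0 := by
  obtain ⟨P, hP, rfl⟩ := hΘ
  obtain ⟨Q, -, -, hQP⟩ := exists_inverse_mem_SO31 hP
  intro h
  apply Om_ne_zero he
  have h2 := congrArg (tilde Q) h
  rwa [← LinearMap.comp_apply, ← tilde_comp, hQP, tilde_id, map_zero] at h2

theorem hHat_self_of_mem_orbit (he : IsPseudoOrthonormal e) {Θ : Bivec}
    (hΘ : Θ ∈ orbit (Om e (Real.pi / 2))) : hHat Θ Θ = 0 ∧ hHat Θ (hodge e Θ) = 0 := by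
  obtain ⟨P, hP, rfl⟩ := hΘ
  rw [hodge_tilde he hP, hHat_tilde hP, hHat_tilde hP]
  exact hHat_Om_self he

/-! ### The distribution of complex lines -/

variable (e) in
/-- The span of `Θ` and `*Θ`: the complex line through `Θ` for the complex structure `*`. -/
def hodgeLine (Θ : Bivec) : Submodule ℝ Bivec := Submodule.span ℝ {Θ, hodge e Θ}

theorem mem_hodgeLine {Θ v : Bivec} :
    v ∈ hodgeLine e Θ ↔ ∃ a b : ℝ, a • Θ + b • hodge e Θ = v :=
  Submodule.mem_span_pair

theorem self_mem_hodgeLine (Θ : Bivec) : Θ ∈ hodgeLine e Θ := Submodule.subset_span (by simp)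

theorem hodge_mem_hodgeLine (he : IsPseudoOrthonormal e) {Θ v : Bivec} (hv : v ∈ hodgeLine e Θ) :
    hodge e v ∈ hodgeLine e Θ := by
  obtain ⟨a, b, rfl⟩ := mem_hodgeLine.1 hv
  refine mem_hodgeLine.2 ⟨-b, a, ?_⟩
  rw [map_add, map_smul, map_smul, hodge_hodge he]
  module

/-- Complex lines are closed under `*`, so a complex line contains that of each of its vectors. -/
theorem hodgeLine_le (he : IsPseudoOrthonormal e) {Θ v : Bivec} (hv : v ∈ hodgeLine e Θ) :
    hodgeLine e v ≤ hodgeLine e Θ := by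
  rw [hodgeLine, Submodule.span_le]
  rintro w (rfl | rfl)
  · exact hv
  · exact hodge_mem_hodgeLine he hv

theorem linearIndependent_hodge (he : IsPseudoOrthonormal e) {Θ : Bivec} (hΘ : Θ ≠ 0) :
    LinearIndependent ℝ ![Θ, hodge e Θ] := by
  rw [LinearIndependent.pair_iff]
  intro a b h
  have h2 := congrArg (hodge e) h
  rw [map_add, map_smul, map_smul, hodge_hodge he, map_zero] at h2
  have h3 : (a * a + b * b) • Θ = 0 := by
    have : (a * a + b * b) • Θ = a • (a • Θ + b • hodge e Θ) - b • (a • hodge e Θ + b • -Θ) := by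
      module
    rw [this, h, h2, smul_zero, smul_zero, sub_zero]
  have h4 := (smul_eq_zero.1 h3).resolve_right hΘ
  exact ⟨by nlinarith [mul_self_nonneg a, mul_self_nonneg b],
    by nlinarith [mul_self_nonneg a, mul_self_nonneg b]⟩

theorem hodgeLine_eq_span_range (Θ : Bivec) :
    hodgeLine e Θ = Submodule.span ℝ (range ![Θ, hodge e Θ]) := by
  rw [hodgeLine, Matrix.range_cons, Matrix.range_cons, Matrix.range_empty, union_empty]
  rfl

theorem hHat_eq_zero_of_mem_hodgeLine (he : IsPseudoOrthonormal e) {Θ : Bivec}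
    (hΘ : Θ ∈ orbit (Om e (Real.pi / 2))) {v w : Bivec} (hv : v ∈ hodgeLine e Θ)
    (hw : w ∈ hodgeLine e Θ) : hHat v w = 0 := by
  obtain ⟨a, b, rfl⟩ := mem_hodgeLine.1 hv
  obtain ⟨c, d, rfl⟩ := mem_hodgeLine.1 hw
  obtain ⟨h1, h2⟩ := hHat_self_of_mem_orbit he hΘ
  simp only [map_add, map_smul, LinearMap.add_apply, LinearMap.smul_apply, hHat_hodge_left he,
    hodge_hodge he, map_neg, h1, h2, smul_zero, neg_zero, add_zero]

/-- Polar coordinates on the punctured complex line through `T̃_P Ω`. -/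
theorem exists_sweep_eq (he : IsPseudoOrthonormal e) {P : E41 →ₗ[ℝ] E41} (hP : P ∈ SO31)
    {w : Bivec} (hw : w ∈ hodgeLine e (tilde P (Om e (Real.pi / 2)))) (hw0 : w ≠ 0) :
    ∃ θ t, w = sweep e P θ t (Om e (Real.pi / 2)) := by
  obtain ⟨a, b, rfl⟩ := mem_hodgeLine.1 hw
  let z : ℂ := ⟨a, b⟩
  have hz : z ≠ 0 := by
    intro hz
    have ha : a = 0 := congrArg Complex.re hz
    have hb : b = 0 := congrArg Complex.im hz
    apply hw0
    simp [ha, hb]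
  -- The radius `‖z‖` is `exp (-t)`.
  refine ⟨z.arg, -Real.log ‖z‖, ?_⟩
  rw [sweep_Om he hP, neg_neg, Real.exp_log (norm_pos_iff.2 hz), Complex.norm_mul_cos_arg,
    Complex.norm_mul_sin_arg]

theorem mem_orbit_of_mem_hodgeLine (he : IsPseudoOrthonormal e) {Θ w : Bivec}
    (hΘ : Θ ∈ orbit (Om e (Real.pi / 2))) (hw : w ∈ hodgeLine e Θ) (hw0 : w ≠ 0) :
    w ∈ orbit (Om e (Real.pi / 2)) := by
  obtain ⟨P, hP, rfl⟩ := hΘ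
  obtain ⟨θ, t, rfl⟩ := exists_sweep_eq he hP hw hw0
  exact sweep_Om_mem_orbit he hP θ t

/-! ### Tangent spaces of the orbit and the radical -/

theorem mem_tangentSpaceAt {L : Set Bivec} {γ : ℝ → Bivec} {v : Bivec} (hγ : ContDiff ℝ ∞ γ)
    (hL : ∀ s, γ s ∈ L) (hv : HasDerivAt γ v 0) : v ∈ tangentSpaceAt L (γ 0) :=
  Submodule.subset_span ⟨γ, hγ, hL, rfl, hv.deriv⟩

theorem hodgeLine_le_tangentSpaceAt (he : IsPseudoOrthonormal e) {Θ : Bivec}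
    (hΘ : Θ ∈ orbit (Om e (Real.pi / 2))) :
    hodgeLine e Θ ≤ tangentSpaceAt (orbit (Om e (Real.pi / 2))) Θ := by
  obtain ⟨P, hP, rfl⟩ := hΘ
  rw [hodgeLine, Submodule.span_le]
  rintro w (rfl | rfl)
  · set A := tilde P (Om e (Real.pi / 2)) with hA
    have h := mem_tangentSpaceAt (L := orbit (Om e (Real.pi / 2)))
      (γ := fun s => Real.exp s • A) (v := A) (by fun_prop) (fun s => ?_) ?_
    · simpa using h
    · simpa [sweep_Om he hP] using sweep_Om_mem_orbit he hP 0 (-s)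
    · simpa using (Real.hasDerivAt_exp 0).smul_const A
  · set A := tilde P (Om e (Real.pi / 2)) with hA
    have h := mem_tangentSpaceAt (L := orbit (Om e (Real.pi / 2)))
      (γ := fun s => Real.cos s • A + Real.sin s • hodge e A) (v := hodge e A) (by fun_prop)
      (fun s => ?_) ?_
    · simpa using h
    · simpa [sweep_Om he hP] using sweep_Om_mem_orbit he hP s 0
    · have h' := ((Real.hasDerivAt_cos 0).smul_const A).fun_add
        ((Real.hasDerivAt_sin 0).smul_const (hodge e A))
      simpa using h'

/-- Velocities of rotations in the planes of `e₁, e₂` and `e₂, e₃`, which move `Ω` out of its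
complex line. -/
theorem tilde_om_mem_tangentSpaceAt (he : IsPseudoOrthonormal e) {P : E41 →ₗ[ℝ] E41}
    (hP : P ∈ SO31) :
    tilde P (om e 0 2) ∈
      tangentSpaceAt (orbit (Om e (Real.pi / 2))) (tilde P (Om e (Real.pi / 2))) ∧
    tilde P (om e 1 3) ∈
      tangentSpaceAt (orbit (Om e (Real.pi / 2))) (tilde P (Om e (Real.pi / 2))) := by
  have h2 : √(2 : ℝ) ≠ 0 := by positivity
  constructor
  · have h := mem_tangentSpaceAt (L := orbit (Om e (Real.pi / 2)))
      (γ := fun s => √2 • (Real.cos s • tilde P (om e 1 2) - Real.sin s • tilde P (om e 0 2)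
        + tilde P (om e 2 3))) (v := √2 • (-tilde P (om e 0 2))) (by fun_prop) (fun s => ?_) ?_
    · have h' := Submodule.smul_mem _ (-(√2)⁻¹) h
      rw [smul_smul, neg_mul, inv_mul_cancel₀ h2, neg_smul, one_smul, neg_neg] at h'
      simpa [Om_pi_div_two] using h'
    · refine ⟨P ∘ₗ rot01 e s, comp_mem_SO31 hP (rot01_mem_SO31 he s), ?_⟩
      rw [tilde_comp, LinearMap.comp_apply, tilde_rot01_Om]
      simp
    · have h' := ((((Real.hasDerivAt_cos 0).smul_const (tilde P (om e 1 2))).fun_sub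
        ((Real.hasDerivAt_sin 0).smul_const (tilde P (om e 0 2)))).add_const
        (tilde P (om e 2 3))).const_smul √2
      refine h'.congr_deriv ?_
      simp
  · have h := mem_tangentSpaceAt (L := orbit (Om e (Real.pi / 2)))
      (γ := fun s => √2 • (tilde P (om e 1 2) + Real.cos s • tilde P (om e 2 3)
        - Real.sin s • tilde P (om e 1 3))) (v := √2 • (-tilde P (om e 1 3))) (by fun_prop)
      (fun s => ?_) ?_
    · have h' := Submodule.smul_mem _ (-(√2)⁻¹) h
      rw [smul_smul, neg_mul, inv_mul_cancel₀ h2, neg_smul, one_smul, neg_neg] at h'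
      simpa [Om_pi_div_two] using h'
    · refine ⟨P ∘ₗ rot12 e s, comp_mem_SO31 hP (rot12_mem_SO31 he s), ?_⟩
      rw [tilde_comp, LinearMap.comp_apply, tilde_rot12_Om]
      simp
    · have h' := ((((Real.hasDerivAt_cos 0).smul_const (tilde P (om e 2 3))).const_add
        (tilde P (om e 1 2))).fun_sub
        ((Real.hasDerivAt_sin 0).smul_const (tilde P (om e 1 3)))).const_smul √2
      refine h'.congr_deriv ?_
      simp

/-- The tangent space is orthogonal to `Θ` and `*Θ`, as seen by differentiating the equations
`ĥ(Θ, Θ) = 0` and `ĥ(Θ, *Θ) = 0` of the orbit. -/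
theorem hHat_eq_zero_of_mem_tangentSpaceAt (he : IsPseudoOrthonormal e) {Θ v : Bivec}
    (hv : v ∈ tangentSpaceAt (orbit (Om e (Real.pi / 2))) Θ) :
    hHat v Θ = 0 ∧ hHat v (hodge e Θ) = 0 := by
  have key : ∀ B : LinearMap.BilinForm ℝ Bivec, (∀ x y, B x y = B y x) →
      (∀ Θ ∈ orbit (Om e (Real.pi / 2)), B Θ Θ = 0) → B v Θ = 0 := by
    intro B hs h0
    refine Submodule.span_induction (p := fun v _ => B v Θ = 0) ?_ (by simp)
      (fun x y _ _ hx hy => by simp [hx, hy]) (fun a x _ hx => by simp [hx]) hv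
    rintro _ ⟨γ, hγ, hL, rfl, rfl⟩
    have hd : HasDerivAt γ (deriv γ 0) 0 :=
      (hγ.differentiable (by simp)).differentiableAt.hasDerivAt
    have h1 := B.toContinuousBilinearMap.hasDerivAt_of_bilinear (fun _ => hd) (fun _ => hd)
    have h2 : (fun s => B.toContinuousBilinearMap (γ s) (γ s)) = fun _ => (0 : ℝ) := by
      funext s
      exact h0 _ (hL s)
    rw [h2] at h1
    have h3 : B (γ 0) (deriv γ 0) + B (deriv γ 0) (γ 0) = 0 := h1.unique (hasDerivAt_const _ _)
    rw [hs (γ 0)] at h3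
    linarith
  refine ⟨key hHat (hHat_comm he) fun Θ hΘ => (hHat_self_of_mem_orbit he hΘ).1, ?_⟩
  refine key (hHat.compl₂ (hodge e)) (fun x y => ?_)
    fun Θ hΘ => (hHat_self_of_mem_orbit he hΘ).2
  rw [LinearMap.compl₂_apply, LinearMap.compl₂_apply, ← hHat_hodge_left he, hHat_comm he]

/-- The orthogonality conditions satisfied by a vector of the radical at `Ω` cut out the complex
line through `Ω`. -/
theorem mem_hodgeLine_Om (he : IsPseudoOrthonormal e) {v : Bivec}
    (h1 : hHat v (Om e (Real.pi / 2)) = 0) (h2 : hHat v (hodge e (Om e (Real.pi / 2))) = 0)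
    (h3 : hHat v (om e 0 2) = 0) (h4 : hHat v (om e 1 3) = 0) :
    v ∈ hodgeLine e (Om e (Real.pi / 2)) := by
  have hr : √(2 : ℝ) ≠ 0 := by positivity
  have c02 : coef e 0 2 v = 0 := by simp [coef, h3]
  have c13 : coef e 1 3 v = 0 := by simp [coef, h4]
  have c1 : coef e 2 3 v = coef e 1 2 v := by
    rw [Om_pi_div_two, map_smul, map_add, smul_eq_zero] at h1
    have := h1.resolve_left hr
    simp [coef, sgn]
    linarith
  have c2 : coef e 0 3 v = -coef e 0 1 v := by
    rw [hodge_Om he, map_smul, map_sub, smul_eq_zero] at h2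
    have := h2.resolve_left hr
    simp [coef, sgn]
    linarith
  refine mem_hodgeLine.2 ⟨(√2)⁻¹ * coef e 1 2 v, (√2)⁻¹ * coef e 0 1 v, ?_⟩
  conv_rhs => rw [eq_frame he v, c02, c13, c1, c2]
  rw [hodge_Om he, Om_pi_div_two, smul_smul, smul_smul, mul_right_comm, inv_mul_cancel₀ hr,
    mul_right_comm, inv_mul_cancel₀ hr]
  module

theorem mem_hodgeLine_iff_radical (he : IsPseudoOrthonormal e) {Θ : Bivec}
    (hΘ : Θ ∈ orbit (Om e (Real.pi / 2))) (v : Bivec) :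
    v ∈ hodgeLine e Θ ↔ v ∈ tangentSpaceAt (orbit (Om e (Real.pi / 2))) Θ ∧
      ∀ w ∈ tangentSpaceAt (orbit (Om e (Real.pi / 2))) Θ, hHat v w = 0 := by
  constructor
  · intro hv
    refine ⟨hodgeLine_le_tangentSpaceAt he hΘ hv, fun w hw => ?_⟩
    obtain ⟨h1, h2⟩ := hHat_eq_zero_of_mem_tangentSpaceAt he hw
    obtain ⟨a, b, rfl⟩ := mem_hodgeLine.1 hv
    rw [hHat_comm he, map_add, map_smul, map_smul, h1, h2, smul_zero, smul_zero, add_zero]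
  · rintro ⟨hv, hw⟩
    obtain ⟨h1, h2⟩ := hHat_eq_zero_of_mem_tangentSpaceAt he hv
    obtain ⟨P, hP, rfl⟩ := hΘ
    obtain ⟨h3, h4⟩ := tilde_om_mem_tangentSpaceAt he hP
    obtain ⟨Q, -, hPQ, -⟩ := exists_inverse_mem_SO31 hP
    have hv' : v = tilde P (tilde Q v) := by
      rw [← LinearMap.comp_apply, ← tilde_comp, hPQ, tilde_id, LinearMap.id_apply]
    have h3' := hw _ h3
    have h4' := hw _ h4
    rw [hodge_tilde he hP] at h2
    rw [hv', hHat_tilde hP] at h1 h2 h3' h4'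
    obtain ⟨a, b, hab⟩ := mem_hodgeLine.1 (mem_hodgeLine_Om he h1 h2 h3' h4')
    refine mem_hodgeLine.2 ⟨a, b, ?_⟩
    rw [hv', ← hab, hodge_tilde he hP, map_add, map_smul, map_smul]

/-! ### Smoothness and involutivity -/

theorem isDistribution_hodgeLine (he : IsPseudoOrthonormal e) :
    IsDistribution (orbit (Om e (Real.pi / 2))) (hodgeLine e) 2 where
  le_tangent _ hΘ := hodgeLine_le_tangentSpaceAt he hΘ
  rank Θ hΘ := by
    rw [hodgeLine_eq_span_range,
      finrank_span_eq_card (linearIndependent_hodge he (ne_zero_of_mem_orbit he hΘ)),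
      Fintype.card_fin]
  smooth Θ₀ _ := by
    refine ⟨univ, isOpen_univ, mem_univ _, ![id, hodge e], fun i => ?_, fun Θ _ => ?_⟩
    · fin_cases i
      · exact contDiffOn_id
      · exact (hodge e).toContinuousLinearMap.contDiff.contDiffOn
    · rw [hodgeLine_eq_span_range]
      congr 2
      ext i
      fin_cases i <;> rfl

/-- Difference quotients of values in a closed subspace stay in it, hence so does their limit. -/
theorem hasDerivAt_mem_submodule {V : Type*} [NormedAddCommGroup V] [NormedSpace ℝ V]
    {f : ℝ → V} {f' : V} {x : ℝ} {K : Submodule ℝ V} [FiniteDimensional ℝ K]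
    (hf : HasDerivAt f f' x) (hK : ∀ᶠ s in nhds x, f s ∈ K) : f' ∈ K := by
  refine K.closed_of_finiteDimensional.mem_of_tendsto hf.tendsto_slope ?_
  filter_upwards [hK.filter_mono nhdsWithin_le_nhds] with s hs
  exact K.smul_mem _ (K.sub_mem hs hK.self_of_nhds)

/-- A section of `hodgeLine` takes its values on the punctured complex line through `Θ` in that
line, and so do its derivatives in the directions of the line. -/
theorem fderiv_mem_hodgeLine (he : IsPseudoOrthonormal e) {U : Set Bivec} (hU : IsOpen U)
    {V : Bivec → Bivec} (hV : ContDiffOn ℝ ∞ V U)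
    (hVD : ∀ Θ ∈ orbit (Om e (Real.pi / 2)) ∩ U, V Θ ∈ hodgeLine e Θ) {Θ : Bivec}
    (hΘ : Θ ∈ orbit (Om e (Real.pi / 2)) ∩ U) {w : Bivec} (hw : w ∈ hodgeLine e Θ) :
    fderiv ℝ V Θ w ∈ hodgeLine e Θ := by
  have hline : HasDerivAt (fun s : ℝ => Θ + s • w) w 0 := by
    simpa using ((hasDerivAt_id (0 : ℝ)).smul_const w).const_add Θ
  have hd : HasFDerivAt V (fderiv ℝ V Θ) (Θ + (0 : ℝ) • w) := by
    rw [zero_smul, add_zero]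
    exact ((hV.contDiffAt (hU.mem_nhds hΘ.2)).differentiableAt (by simp)).hasFDerivAt
  refine hasDerivAt_mem_submodule (hd.comp_hasDerivAt (0 : ℝ) hline) ?_
  have h0 : Θ + (0 : ℝ) • w = Θ := by simp
  have hUe : ∀ᶠ s : ℝ in nhds 0, Θ + s • w ∈ U :=
    hline.continuousAt.eventually_mem (hU.mem_nhds (by simpa using hΘ.2))
  have hne : ∀ᶠ s : ℝ in nhds 0, Θ + s • w ≠ 0 :=
    hline.continuousAt.eventually_ne (by simpa using ne_zero_of_mem_orbit he hΘ.1)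
  filter_upwards [hUe, hne] with s hs hs0
  have hmem : Θ + s • w ∈ hodgeLine e Θ :=
    Submodule.add_mem _ (self_mem_hodgeLine Θ) (Submodule.smul_mem _ s hw)
  exact hodgeLine_le he hmem (hVD _ ⟨mem_orbit_of_mem_hodgeLine he hΘ.1 hmem hs0, hs⟩)

theorem isInvolutive_hodgeLine (he : IsPseudoOrthonormal e) :
    IsInvolutive (orbit (Om e (Real.pi / 2))) (hodgeLine e) := by
  intro U hU V W hV hW hVD hWD Θ hΘ
  rw [VectorField.lieBracket]
  exact Submodule.sub_mem _ (fderiv_mem_hodgeLine he hU hW hWD hΘ (hVD Θ hΘ))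
    (fderiv_mem_hodgeLine he hU hV hVD hΘ (hWD Θ hΘ))

/-! ### Integral surfaces -/

variable (e) in
/-- The linear map `v ↦ v⁰ *Θ - v¹ Θ`, the differential of polar coordinates on the complex line
through `Θ` at the parameters of `Θ`. -/
def polarDeriv (Θ : Bivec) : Plane →L[ℝ] Bivec :=
  (EuclideanSpace.proj (0 : Fin 2) : Plane →L[ℝ] ℝ).smulRight (hodge e Θ)
    - (EuclideanSpace.proj (1 : Fin 2) : Plane →L[ℝ] ℝ).smulRight Θ

theorem polarDeriv_apply (Θ : Bivec) (v : Plane) :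
    polarDeriv e Θ v = v 0 • hodge e Θ - v 1 • Θ := rfl

theorem polarDeriv_injective (he : IsPseudoOrthonormal e) {Θ : Bivec} (hΘ : Θ ≠ 0) :
    Function.Injective (polarDeriv e Θ) := by
  refine (injective_iff_map_eq_zero _).2 fun v hv => ?_
  have h : -(v 1) • Θ + v 0 • hodge e Θ = 0 := by
    rw [← hv, polarDeriv_apply]
    module
  obtain ⟨h1, h0⟩ := LinearIndependent.pair_iff.1 (linearIndependent_hodge he hΘ) _ _ h
  ext i
  fin_cases i
  · exact h0
  · exact neg_eq_zero.1 h1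

theorem range_polarDeriv (Θ : Bivec) :
    LinearMap.range (polarDeriv e Θ).toLinearMap = hodgeLine e Θ := by
  ext w
  rw [mem_hodgeLine, LinearMap.mem_range]
  constructor
  · rintro ⟨v, rfl⟩
    refine ⟨-(v 1), v 0, ?_⟩
    rw [ContinuousLinearMap.coe_coe, polarDeriv_apply]
    module
  · rintro ⟨a, b, rfl⟩
    refine ⟨!₂[b, -a], ?_⟩
    simp [polarDeriv_apply]
    abel

theorem hasFDerivAt_sweep_Om (he : IsPseudoOrthonormal e) {P : E41 →ₗ[ℝ] E41} (hP : P ∈ SO31)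
    (q : Plane) :
    HasFDerivAt (fun q : Plane => sweep e P (q 0) (q 1) (Om e (Real.pi / 2)))
      (polarDeriv e (sweep e P (q 0) (q 1) (Om e (Real.pi / 2)))) q := by
  have h0 : HasFDerivAt (fun q : Plane => q 0)
    (EuclideanSpace.proj (0 : Fin 2) : Plane →L[ℝ] ℝ) q :=
    (EuclideanSpace.proj (0 : Fin 2) : Plane →L[ℝ] ℝ).hasFDerivAt
  have h1 : HasFDerivAt (fun q : Plane => q 1)
    (EuclideanSpace.proj (1 : Fin 2) : Plane →L[ℝ] ℝ) q :=
    (EuclideanSpace.proj (1 : Fin 2) : Plane →L[ℝ] ℝ).hasFDerivAt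
  simp only [sweep_Om he hP]
  refine (((h1.neg.exp.mul h0.cos).smul_const _).add
    ((h1.neg.exp.mul h0.sin).smul_const _)).congr_fderiv ?_
  ext v
  simp [polarDeriv_apply, hodge_hodge he]
  module

theorem isIntegralSurface_sweep_Om (he : IsPseudoOrthonormal e) {P : E41 →ₗ[ℝ] E41}
    (hP : P ∈ SO31) :
    IsIntegralSurface (orbit (Om e (Real.pi / 2))) (hodgeLine e)
      (fun q : Plane => sweep e P (q 0) (q 1) (Om e (Real.pi / 2))) where
  connected := inferInstance
  smooth := by
    rw [contMDiff_iff_contDiff]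
    simp only [sweep_Om he hP]
    fun_prop
  mem q := sweep_Om_mem_orbit he hP _ _
  immersion q := by
    rw [mfderiv_eq_fderiv, (hasFDerivAt_sweep_Om he hP q).fderiv]
    exact polarDeriv_injective he (ne_zero_of_mem_orbit he (sweep_Om_mem_orbit he hP _ _))
  tangent q := by
    rw [mfderiv_eq_fderiv, (hasFDerivAt_sweep_Om he hP q).fderiv]
    exact range_polarDeriv _

variable (e) in
/-- The complex coordinates `ω₁₂ - i ω₃₄`, `ω₁₃ + i ω₂₄`, `ω₁₄ + i ω₂₃` (in terms of coefficients)
of a bivector. The signs are those for which `*` becomes multiplication by `i`. -/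
def cplxCoord : Fin 3 → Bivec →ₗ[ℝ] ℂ :=
  ![(coef e 0 1).smulRight 1 - (coef e 2 3).smulRight Complex.I,
    (coef e 0 2).smulRight 1 + (coef e 1 3).smulRight Complex.I,
    (coef e 0 3).smulRight 1 + (coef e 1 2).smulRight Complex.I]

theorem cplxCoord_hodge (he : IsPseudoOrthonormal e) (k : Fin 3) (v : Bivec) :
    cplxCoord e k (hodge e v) = Complex.I * cplxCoord e k v := by
  obtain ⟨h1, h2, h3, h4, h5, h6⟩ := coef_hodge he v
  fin_cases k <;> simp [cplxCoord, *, Complex.ext_iff]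

theorem eq_of_cplxCoord_eq (he : IsPseudoOrthonormal e) {v w : Bivec}
    (h : ∀ k, cplxCoord e k v = cplxCoord e k w) : v = w := by
  have h0 := h 0
  have h1 := h 1
  have h2 := h 2
  simp [cplxCoord, Complex.ext_iff] at h0 h1 h2
  exact eq_of_coef_eq he h0.1 h1.1 h2.1 h2.2 h1.2 h0.2

theorem cplxCoord_smul_add (he : IsPseudoOrthonormal e) (k : Fin 3) (a b : ℝ) (v : Bivec) :
    cplxCoord e k (a • v + b • hodge e v) = (a + b * Complex.I) * cplxCoord e k v := by
  rw [map_add, map_smul, map_smul, cplxCoord_hodge he, Complex.real_smul, Complex.real_smul]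
  ring

/-- A curve whose velocity stays in the complex line of its position stays in one complex line:
the quotients of its complex coordinates have zero derivative. -/
theorem mem_hodgeLine_of_curve (he : IsPseudoOrthonormal e) {γ γ' : ℝ → Bivec}
    (hd : ∀ s ∈ Icc (0 : ℝ) 1, HasDerivAt γ (γ' s) s)
    (hD : ∀ s ∈ Icc (0 : ℝ) 1, γ' s ∈ hodgeLine e (γ s)) {k : Fin 3}
    (hk : ∀ s ∈ Icc (0 : ℝ) 1, cplxCoord e k (γ s) ≠ 0) : γ 1 ∈ hodgeLine e (γ 0) := by
  have hder : ∀ j, ∀ s ∈ Icc (0 : ℝ) 1, HasDerivAt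
      (fun s => cplxCoord e j (γ s) / cplxCoord e k (γ s)) 0 s := by
    intro j s hs
    have hj : ∀ j, HasDerivAt (fun s => cplxCoord e j (γ s)) (cplxCoord e j (γ' s)) s := fun j =>
      (cplxCoord e j).toContinuousLinearMap.hasFDerivAt.comp_hasDerivAt s (hd s hs)
    refine ((hj j).fun_div (hj k) (hk s hs)).congr_deriv ?_
    obtain ⟨a, b, hab⟩ := mem_hodgeLine.1 (hD s hs)
    rw [← hab, cplxCoord_smul_add he, cplxCoord_smul_add he]
    ring
  have hconst : ∀ j, cplxCoord e j (γ 1) / cplxCoord e k (γ 1) =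
      cplxCoord e j (γ 0) / cplxCoord e k (γ 0) := fun j =>
    constant_of_has_deriv_right_zero
      (fun s hs => (hder j s hs).continuousAt.continuousWithinAt)
      (fun s hs => (hder j s (Ico_subset_Icc_self hs)).hasDerivWithinAt) 1 (by simp)
  have hk0 := hk 0 (by simp)
  have hk1 := hk 1 (by simp)
  set c : ℂ := cplxCoord e k (γ 1) / cplxCoord e k (γ 0) with hc
  refine mem_hodgeLine.2 ⟨c.re, c.im, eq_of_cplxCoord_eq he fun j => ?_⟩
  rw [cplxCoord_smul_add he, Complex.re_add_im, hc]
  have h := hconst j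
  field_simp at h ⊢
  linear_combination -h

/-- A map whose differential takes values in the complex line of its position stays, near a point
where it does not vanish, in one complex line. -/
theorem eventually_mem_hodgeLine (he : IsPseudoOrthonormal e) {G : Plane → Bivec} {x₀ : Plane}
    (hd : ∀ᶠ x in nhds x₀, DifferentiableAt ℝ G x)
    (hD : ∀ᶠ x in nhds x₀, ∀ v, fderiv ℝ G x v ∈ hodgeLine e (G x)) (h0 : G x₀ ≠ 0) :
    ∀ᶠ x in nhds x₀, G x ∈ hodgeLine e (G x₀) := by
  obtain ⟨k, hk⟩ : ∃ k, cplxCoord e k (G x₀) ≠ 0 := by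
    by_contra! h
    exact h0 (eq_of_cplxCoord_eq he fun k => by rw [h, map_zero])
  have hcont : ContinuousAt (fun x => cplxCoord e k (G x)) x₀ :=
    (cplxCoord e k).toContinuousLinearMap.continuous.continuousAt.comp
      hd.self_of_nhds.continuousAt
  obtain ⟨r, hr, hball⟩ := Metric.eventually_nhds_iff_ball.1
    ((hd.and hD).and (hcont.eventually_ne hk))
  refine Metric.eventually_nhds_iff_ball.2 ⟨r, hr, fun x hx => ?_⟩
  have hseg : ∀ s ∈ Icc (0 : ℝ) 1, x₀ + s • (x - x₀) ∈ Metric.ball x₀ r := fun s hs =>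
    (convex_ball x₀ r).add_smul_sub_mem (Metric.mem_ball_self hr) hx hs
  have hline : ∀ s : ℝ, HasDerivAt (fun s : ℝ => x₀ + s • (x - x₀)) (x - x₀) s := fun s => by
    simpa using ((hasDerivAt_id s).smul_const (x - x₀)).const_add x₀
  have h := mem_hodgeLine_of_curve he (γ := fun s => G (x₀ + s • (x - x₀)))
    (γ' := fun s => fderiv ℝ G (x₀ + s • (x - x₀)) (x - x₀))
    (fun s hs => (hball _ (hseg s hs)).1.1.hasFDerivAt.comp_hasDerivAt s (hline s))
    (fun s hs => (hball _ (hseg s hs)).1.2 _) (fun s hs => (hball _ (hseg s hs)).2)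
  simpa using h

/-- A connected integral surface lies in the complex line through any of its points: the points
with values in that line form a closed set, which is open by the local statement in charts. -/
theorem mem_hodgeLine_of_isIntegralSurface (he : IsPseudoOrthonormal e) {M : Type*}
    [TopologicalSpace M] [ChartedSpace Plane M] [IsManifold (𝓡 2) ∞ M] {F : M → Bivec}
    (hF : IsIntegralSurface (orbit (Om e (Real.pi / 2))) (hodgeLine e) F) {Θ : Bivec}
    (hΘ : Θ ∈ range F) (p : M) : F p ∈ hodgeLine e Θ := by
  have := hF.connected
  have : IsManifold (𝓡 2) 1 M := IsManifold.of_le (n := ∞) (by simp)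
  have hFc : Continuous F := hF.smooth.continuous
  have hclosed : IsClosed {p | F p ∈ hodgeLine e Θ} :=
    (hodgeLine e Θ).closed_of_finiteDimensional.preimage hFc
  have hopen : IsOpen {p | F p ∈ hodgeLine e Θ} := by
    rw [isOpen_iff_mem_nhds]
    intro p hp
    set c := chartAt Plane p with hc
    have hcp : c.symm (c p) = p := c.left_inv (mem_chart_source Plane p)
    have htarget : ∀ᶠ x in nhds (c p), x ∈ c.target :=
      c.open_target.mem_nhds (mem_chart_target Plane p)
    have hFd : ∀ q, MDifferentiableAt (𝓡 2) 𝓘(ℝ, Bivec) F q :=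
      hF.smooth.mdifferentiable (by simp)
    have hcd : ∀ x ∈ c.target, MDifferentiableAt (𝓡 2) (𝓡 2) c.symm x := fun x hx =>
      mdifferentiableAt_atlas_symm (chart_mem_atlas Plane p) hx
    have h := eventually_mem_hodgeLine he (G := F ∘ c.symm) (x₀ := c p)
      (htarget.mono fun x hx => ((hFd _).comp x (hcd x hx)).differentiableAt)
      (htarget.mono fun x hx v => ?_) ?_
    · have h' := (c.continuousAt (mem_chart_source Plane p)).eventually h
      filter_upwards [h', chart_source_mem_nhds Plane p] with q hq hqs
      rw [Function.comp_apply, Function.comp_apply, hcp, c.left_inv hqs] at hq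
      exact hodgeLine_le he hp hq
    · rw [← mfderiv_eq_fderiv, mfderiv_comp x (hFd _) (hcd x hx), Function.comp_apply,
        ← hF.tangent]
      exact ⟨_, rfl⟩
    · rw [Function.comp_apply, hcp]
      exact ne_zero_of_mem_orbit he (hF.mem p)
  obtain ⟨p₀, rfl⟩ := hΘ
  have huniv := IsClopen.eq_univ ⟨hclosed, hopen⟩ ⟨p₀, self_mem_hodgeLine (F p₀)⟩
  exact huniv.ge (mem_univ p)

end Frame

end MinkowskiBivector

end

open MinkowskiBivector
open scoped Manifold ContDiff
theorem mainTheorem2 (e : Module.Basis (Fin 4) ℝ E41) (he : IsPseudoOrthonormal e)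
    (φ : ℝ) (hφ : φ = Real.pi / 2) :
    ∃ D : Bivec → Submodule ℝ Bivec,
      IsDistribution (orbit (Om e φ)) D 2 ∧
      IsInvolutive (orbit (Om e φ)) D ∧
      (∀ Θ ∈ orbit (Om e φ), ∀ v : Bivec,
        v ∈ D Θ ↔ v ∈ tangentSpaceAt (orbit (Om e φ)) Θ ∧
          ∀ w ∈ tangentSpaceAt (orbit (Om e φ)) Θ, hHat v w = 0) ∧
      (∀ P ∈ SO31, IsIntegralSurface (orbit (Om e φ)) D
        (fun q : Plane => sweep e P (q 0) (q 1) (Om e φ))) ∧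
      ∀ (M : Type*) [TopologicalSpace M] [ChartedSpace Plane M] [IsManifold (𝓡 2) ∞ M]
        (F : M → Bivec), IsIntegralSurface (orbit (Om e φ)) D F →
        ∀ P ∈ SO31, tilde P (Om e φ) ∈ Set.range F →
          (∀ p, ∃ θ t : ℝ, F p = sweep e P θ t (Om e φ)) ∧
          ∀ s : ℝ, s = 1 ∨ s = -1 →
            ∃ X Y : M → Bivec,
              IsTransported e P (Om e φ) F (Xpm e φ s) X ∧
              IsTransported e P (Om e φ) F (Ypm e s) Y ∧
              ContMDiff (𝓡 2) 𝓘(ℝ, Bivec) ∞ X ∧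
              ContMDiff (𝓡 2) 𝓘(ℝ, Bivec) ∞ Y ∧
              ∀ (p : M) (v : TangentSpace (𝓡 2) p),
                (covDeriv X p v = 0 ∨ IsLightlike (covDeriv X p v)) ∧
                covDeriv X p v ∈
                  LinearMap.range (mfderiv (𝓡 2) 𝓘(ℝ, Bivec) F p).toLinearMap ∧
                covDeriv Y p v = 0 := by
  subst hφ
  refine ⟨hodgeLine e, isDistribution_hodgeLine he, isInvolutive_hodgeLine he,
    fun Θ hΘ v => mem_hodgeLine_iff_radical he hΘ v,
    fun P hP => isIntegralSurface_sweep_Om he hP, ?_⟩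
  intro M _ _ _ F hF P hP hPF
  refine ⟨fun p => exists_sweep_eq he hP (mem_hodgeLine_of_isIntegralSurface he hF hPF p)
    (ne_zero_of_mem_orbit he (hF.mem p)), fun s _ => ?_⟩
  let L : Bivec →L[ℝ] Bivec :=
    ((1 / 2 : ℝ) • (s • LinearMap.id + hodge e)).toContinuousLinearMap
  have hL : ∀ w, L w = (1 / 2 : ℝ) • (s • w + hodge e w) := fun w => rfl
  refine ⟨L ∘ F, fun _ => tilde P (Ypm e s), fun p θ t h => ?_, fun p θ t _ => ?_,
    L.contMDiff.comp hF.smooth, contMDiff_const, fun p v => ?_⟩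
  · rw [Function.comp_apply, h, hL, sweep_Xpm he hP]
  · rw [sweep_Ypm]
  · obtain ⟨u, hu⟩ : ∃ u : Bivec, u = mfderiv (𝓡 2) 𝓘(ℝ, Bivec) F p v := ⟨_, rfl⟩
    have hd : covDeriv (L ∘ F) p v = L u := by
      rw [covDeriv, mfderiv_comp p L.mdifferentiableAt (hF.smooth.mdifferentiable (by simp) p),
        L.mfderiv_eq, hu]
      rfl
    have hv : u ∈ hodgeLine e (F p) := by
      rw [← hF.tangent p]
      exact ⟨v, hu.symm⟩
    have hX : covDeriv (L ∘ F) p v ∈ hodgeLine e (F p) := by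
      rw [hd, hL]
      exact Submodule.smul_mem _ _
        (Submodule.add_mem _ (Submodule.smul_mem _ _ hv) (hodge_mem_hodgeLine he hv))
    refine ⟨?_, by rw [hF.tangent]; exact hX, ?_⟩
    · by_cases h0 : covDeriv (L ∘ F) p v = 0
      · exact Or.inl h0
      · exact Or.inr ⟨h0, hHat_eq_zero_of_mem_hodgeLine he (hF.mem p) hX hX⟩
    · rw [covDeriv, mfderiv_const]
      rfl
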